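/- Let $(W,S)$ be a Coxeter system with $S$ finite, $|S|=n$, and orders $m_{st}$, and let $B$ be a real symmetric matrix with $B_{st}=-\cos(\pi/m_{st})$ if $m_{st}<\infty$ and $B_{st}=-c_{st}$ if $m_{st}=\infty$, where the $c_{st}=c_{ts}\ge 1$ are arbitrary. Let $V$ be the real vector space with basis $\Delta=\{\alpha_s\}_{s\in S}$ (the simple roots) and bilinear form $\mathcal B$ with $\mathcal B(\alpha_s,\alpha_t)=B_{st}$, and let $W$ act linearly on $V$ by letting $s\in S$ act as the reflection $\mathbf x\mapsto \mathbf x-2\frac{\mathcal B(\mathbf x,\alpha_s)}{\mathcal B(\alpha_s,\alpha_s)}\alpha_s$. Let $\Phi=W(\Delta)$ be the set of roots. For $0\ne\mathbf x\in V$ write $\widehat{\mathbf x}\in\mathbb PV$ for its direction; $W$ acts on $\mathbb PV$ by $w\cdot\widehat{\mathbf x}=\widehat{w(\mathbf x)}$. A limit root is a point of $\mathbb PV$ that is the limit of $(\widehat{\gamma_i})_{i\in\mathbb N}$ for some injective sequence $(\gamma_i)_{i\in\mathbb N}$ in $\Phi$. Assume that $\mathcal B$ has signature $(n-1,1)$.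 Let $w\in W$ be parabolic, that is, all eigenvalues of $w$ on $V_{\mathbb C}=\mathbb C\otimes V$ have modulus $1$, but $w$ is not diagonalizable on $V_{\mathbb C}$. Let $U_w\subset V$ be the real subspace spanned by the unimodular eigenvectors of $w$, that is, the set of vectors of $V$ lying in the complex span of the eigenvectors of $w$ in $V_{\mathbb C}$ with eigenvalue of modulus $1$. Then $w$ has exactly one light-like eigendirection, that is, exactly one $\widehat{\mathbf x}\in\mathbb PV$ such that $\mathbf x\in V\setminus\{0\}$ is an eigenvector of $w$ with $\mathcal B(\mathbf x,\mathbf x)=0$. This $\widehat{\mathbf x}$ is a limit root. Moreover, for every $\mathbf y\in V\setminus U_w$, the points $w^k\cdot\widehat{\mathbf y}$, $k\in\mathbb N$, are pairwise distinct and converge to $\widehat{\mathbf x}$ as $k\to\infty$. -/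

import Mathlib

open scoped LinearAlgebra.Projectivization TensorProduct Topology

noncomputable section

/-- The projective space of a real topological vector space carries the quotient topology of
`V ∖ {0}`. -/
instance projectivizationTopology (V : Type*) [AddCommGroup V] [Module ℝ V]
    [TopologicalSpace V] : TopologicalSpace (ℙ ℝ V) :=
  TopologicalSpace.coinduced (Projectivization.mk' ℝ : {v : V // v ≠ 0} → ℙ ℝ V) inferInstance

namespace LinearMap.BilinForm

variable {V : Type*} [AddCommGroup V] [Module ℝ V]

/-- The reflection `σ_α(x) = x - 2 B(x, α) / B(α, α) • α` in a non-isotropic vector `α`. -/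
def vectorReflection (B : LinearMap.BilinForm ℝ V) (α : V) (h : B α α ≠ 0) : V ≃ₗ[ℝ] V :=
  Module.reflection (x := α) (f := (2 / B α α) • B.flip α) (by simp [h])

theorem vectorReflection_apply (B : LinearMap.BilinForm ℝ V) (α : V) (h : B α α ≠ 0) (x : V) :
    B.vectorReflection α h x = x - (2 * (B x α / B α α)) • α := by
  simp only [vectorReflection, Module.reflection_apply, LinearMap.smul_apply,
    LinearMap.BilinForm.flip_apply, smul_eq_mul]
  congr 2
  ring

/-- `B` is Lorentzian: it has signature `(n - 1, 1)`, where `n = dim V`. -/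
def IsLorentzian (B : LinearMap.BilinForm ℝ V) : Prop :=
  sigPos B.toQuadraticMap + 1 = Module.finrank ℝ V ∧ sigNeg B.toQuadraticMap = 1

end LinearMap.BilinForm

namespace Module.End

variable {V : Type*} [AddCommGroup V] [Module ℝ V]

/-- The complexification of a real endomorphism, acting on `ℂ ⊗ V`. -/
abbrev complexify (φ : Module.End ℝ V) : Module.End ℂ (ℂ ⊗[ℝ] V) := LinearMap.baseChange ℂ φ

/-- Diagonalizability over `ℂ`: the complexification is spanned by its eigenvectors. -/
def IsComplexDiagonalizable (φ : Module.End ℝ V) : Prop :=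
  Submodule.span ℂ {z : ℂ ⊗[ℝ] V | ∃ μ : ℂ, φ.complexify.HasEigenvector μ z} = ⊤

/-- Parabolic transformations: all complex eigenvalues are unimodular, but the transformation is
not diagonalizable. -/
def IsParabolic (φ : Module.End ℝ V) : Prop :=
  (∀ μ : ℂ, φ.complexify.HasEigenvalue μ → ‖μ‖ = 1) ∧ ¬ φ.IsComplexDiagonalizable

/-- The unimodular subspace: the real vectors in the span of the complex unimodular
eigenvectors. -/
def unimodularSubspace (φ : Module.End ℝ V) : Submodule ℝ V :=
  ((Submodule.span ℂ {z : ℂ ⊗[ℝ] V | ∃ μ : ℂ, ‖μ‖ = 1 ∧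
    φ.complexify.HasEigenvector μ z}).restrictScalars ℝ).comap (TensorProduct.mk ℝ ℂ V 1)

/-- `p` is a light-like eigendirection of `φ` with respect to the form `B`. -/
def IsLightlikeEigendirection (B : LinearMap.BilinForm ℝ V) (φ : Module.End ℝ V)
    (p : ℙ ℝ V) : Prop :=
  ∃ (x : V) (hx : x ≠ 0), p = Projectivization.mk ℝ x hx ∧ B x x = 0 ∧
    ∃ μ : ℝ, φ.HasEigenvector μ x

end Module.End

/-- A geometric Coxeter system `(W, S)_B`: a Coxeter system together with a choice of the entries
`-c s t` of `B` for the pairs with `m s t = ∞` (encoded by `M s t = 0`).  The values of `c` at all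
other pairs are irrelevant. -/
structure GeometricCoxeterSystem {S : Type*} (M : CoxeterMatrix S) (W : Type*) [Group W] where
  toCoxeterSystem : CoxeterSystem M W
  c : S → S → ℝ
  c_symm : ∀ s t, M s t = 0 → c s t = c t s
  one_le_c : ∀ s t, M s t = 0 → 1 ≤ c s t

namespace GeometricCoxeterSystem

variable {S : Type*} {M : CoxeterMatrix S} {W : Type*} [Group W]
  (G : GeometricCoxeterSystem M W)

/-- The matrix `B`. -/
def gram : Matrix S S ℝ :=
  Matrix.of fun s t => if M s t = 0 then -G.c s t else -Real.cos (Real.pi / M s t)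

theorem gram_symm (s t : S) : G.gram s t = G.gram t s := by
  simp only [gram, Matrix.of_apply, M.symmetric t s]
  split_ifs with h
  · rw [G.c_symm s t h]
  · rfl

variable [Fintype S] [DecidableEq S]

/-- The bilinear form on `V = ℝ^S` with matrix `B` in the standard basis `Δ`. -/
def form : LinearMap.BilinForm ℝ (S → ℝ) := Matrix.toBilin' G.gram

/-- The simple root `α_s`, a vector of the standard basis. -/
def simpleRoot (_G : GeometricCoxeterSystem M W) (s : S) : S → ℝ := Pi.single s 1

theorem form_simpleRoot (s t : S) :
    G.form (G.simpleRoot s) (G.simpleRoot t) = G.gram s t := by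
  simp [form, simpleRoot]

theorem form_simpleRoot_self (s : S) : G.form (G.simpleRoot s) (G.simpleRoot s) = 1 := by
  simp [form_simpleRoot, gram]

/-- The simple reflection `σ_{α_s}`. -/
def simpleReflection (s : S) : (S → ℝ) ≃ₗ[ℝ] (S → ℝ) :=
  G.form.vectorReflection (G.simpleRoot s) (by simp [form_simpleRoot_self])

theorem chebyshevS_eval_two_cos_mul_sin (θ : ℝ) (n : ℕ) :
    (Polynomial.Chebyshev.S ℝ n).eval (2 * Real.cos θ) * Real.sin θ
      = Real.sin ((n + 1) * θ) := by
  induction n using Nat.twoStepInduction with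
  | zero => simp
  | one =>
    norm_num
    rw [Real.sin_two_mul]; ring
  | more n h1 h2 =>
    push_cast at h2 ⊢
    rw [Polynomial.Chebyshev.S_add_two]
    simp only [Polynomial.eval_sub, Polynomial.eval_mul, Polynomial.eval_X, sub_mul, h1]
    rw [mul_assoc, h2]
    have e1 : ((n : ℝ) + 2 + 1) * θ = (n + 1 + 1) * θ + θ := by ring
    have e2 : ((n : ℝ) + 1) * θ = (n + 1 + 1) * θ - θ := by ring
    rw [e1, e2, Real.sin_add, Real.sin_sub]
    ring

/-- The simple reflections satisfy the Coxeter relations. -/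
theorem simpleReflection_isLiftable : M.IsLiftable G.simpleReflection := by
  intro s t
  rcases eq_or_ne s t with rfl | hst
  · rw [M.diagonal, pow_one]
    apply LinearEquiv.ext
    intro x
    exact Module.involutive_reflection (by simp [form_simpleRoot_self]) x
  rcases Nat.eq_zero_or_pos (M s t) with h0 | hpos
  · rw [h0, pow_zero]
  have h1 := M.off_diagonal s t hst
  have hm2 : 2 ≤ M s t := by omega
  have hg : G.gram s t = -Real.cos (Real.pi / M s t) := by simp [gram, hpos.ne']
  generalize M s t = m at *
  apply LinearEquiv.ext
  intro z
  set f : Module.Dual ℝ (S → ℝ) :=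
    (2 / G.form (G.simpleRoot s) (G.simpleRoot s)) • G.form.flip (G.simpleRoot s) with hf
  set g : Module.Dual ℝ (S → ℝ) :=
    (2 / G.form (G.simpleRoot t) (G.simpleRoot t)) • G.form.flip (G.simpleRoot t) with hgdef
  have hfs : f (G.simpleRoot s) = 2 := by simp [hf, form_simpleRoot_self]
  have hgt : g (G.simpleRoot t) = 2 := by simp [hgdef, form_simpleRoot_self]
  have hft : f (G.simpleRoot t) = -2 * Real.cos (Real.pi / m) := by
    simp [hf, form_simpleRoot_self, form_simpleRoot, G.gram_symm t s, hg]
  have hgs : g (G.simpleRoot s) = -2 * Real.cos (Real.pi / m) := by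
    simp [hgdef, form_simpleRoot_self, form_simpleRoot, hg]
  have hθ : 2 * Real.cos (2 * (Real.pi / m))
      = f (G.simpleRoot t) * g (G.simpleRoot s) - 2 := by
    rw [hft, hgs, Real.cos_two_mul]; ring
  have key := Module.reflection_mul_reflection_pow_apply hfs hgt m z _ hθ
  change ((Module.reflection hfs * Module.reflection hgt) ^ m) z = z
  rw [key]
  have hm0 : (m : ℝ) ≠ 0 := by positivity
  rcases eq_or_ne m 2 with rfl | hm
  · have c0 : Real.cos (Real.pi / (2 : ℕ)) = 0 := by norm_num
    have c1 : Real.cos (2 * (Real.pi / (2 : ℕ))) = -1 := by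
      rw [Nat.cast_ofNat, mul_div_cancel₀ _ (by norm_num : (2 : ℝ) ≠ 0), Real.cos_pi]
    rw [hft, hgs, c0, c1]
    norm_num [Polynomial.Chebyshev.S_zero, Polynomial.Chebyshev.S_one]
    abel
  have hm3 : 3 ≤ m := by omega
  have hsin : Real.sin (2 * (Real.pi / m)) ≠ 0 := by
    apply ne_of_gt
    apply Real.sin_pos_of_pos_of_lt_pi
    · positivity
    · rw [← mul_div_assoc, div_lt_iff₀ (by positivity), mul_comm]
      have : (3 : ℝ) ≤ m := by exact_mod_cast hm3
      nlinarith [Real.pi_pos]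
  set θ := 2 * (Real.pi / m) with hθdef
  have hmθ : (m : ℝ) * θ = 2 * Real.pi := by rw [hθdef]; field_simp
  rcases Nat.even_or_odd' m with ⟨j, hj | hj⟩
  · obtain ⟨i, rfl⟩ : ∃ i, j = i + 1 := ⟨j - 1, by omega⟩
    have e1 : ((m : ℤ) - 2) / 2 = (i : ℤ) := by omega
    have e2 : ((m : ℤ) - 1) / 2 = (i : ℤ) := by omega
    have hz : (Polynomial.Chebyshev.S ℝ (i : ℤ)).eval (2 * Real.cos θ) = 0 := by
      apply (mul_eq_zero.mp _).resolve_right hsin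
      rw [chebyshevS_eval_two_cos_mul_sin]
      have : ((i : ℝ) + 1) * θ = Real.pi := by
        have h2 : (m : ℝ) = 2 * (i + 1) := by rw [hj]; push_cast; ring
        rw [h2] at hmθ; linarith
      rw [this, Real.sin_pi]
    rw [e1, e2, hz]
    simp
  · obtain ⟨i, rfl⟩ : ∃ i, j = i + 1 := ⟨j - 1, by omega⟩
    have e1 : ((m : ℤ) - 2) / 2 = (i : ℤ) := by omega
    have e2 : ((m : ℤ) - 1) / 2 = ((i + 1 : ℕ) : ℤ) := by omega
    have e3 : ((m : ℤ) - 3) / 2 = (i : ℤ) := by omega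
    have e4 : (m : ℤ) / 2 = ((i + 1 : ℕ) : ℤ) := by omega
    have hz : (Polynomial.Chebyshev.S ℝ ((i + 1 : ℕ) : ℤ)).eval (2 * Real.cos θ)
        + (Polynomial.Chebyshev.S ℝ (i : ℤ)).eval (2 * Real.cos θ) = 0 := by
      apply (mul_eq_zero.mp _).resolve_right hsin
      rw [add_mul, chebyshevS_eval_two_cos_mul_sin, chebyshevS_eval_two_cos_mul_sin]
      have : (((i + 1 : ℕ) : ℝ) + 1) * θ = 2 * Real.pi - ((i : ℝ) + 1) * θ := by
        have h2 : (m : ℝ) = 2 * (i + 1) + 1 := by rw [hj]; push_cast; ring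
        rw [h2] at hmθ; push_cast; linarith
      rw [this, Real.sin_two_pi_sub]
      ring
    rw [e1, e2, e3, e4, hz]
    simp

/-- The geometric representation `ρ : W → GL(V)`, sending `s` to `σ_{α_s}`. -/
def rep : W →* ((S → ℝ) ≃ₗ[ℝ] (S → ℝ)) :=
  G.toCoxeterSystem.lift ⟨G.simpleReflection, G.simpleReflection_isLiftable⟩

theorem rep_simple (s : S) : G.rep (G.toCoxeterSystem.simple s) = G.simpleReflection s :=
  G.toCoxeterSystem.lift_apply_simple G.simpleReflection_isLiftable s

/-- `(W, S)_B` is Lorentzian: the form has signature `(n - 1, 1)`, where `n = |S| = dim V`. -/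
def IsLorentzian : Prop := G.form.IsLorentzian

/-- The roots `Φ = W(Δ)`. -/
def roots : Set (S → ℝ) := {γ | ∃ (w : W) (s : S), γ = G.rep w (G.simpleRoot s)}

theorem ne_zero_of_mem_roots {γ : S → ℝ} (h : γ ∈ G.roots) : γ ≠ 0 := by
  obtain ⟨w, s, rfl⟩ := h
  simp [simpleRoot]

/-- The set `E_Φ` of limit roots: limits in the projective space of the directions of injective
sequences of roots. -/
def limitRoots : Set (ℙ ℝ (S → ℝ)) :=
  {p | ∃ (γ : ℕ → S → ℝ) (hγ : ∀ i, γ i ∈ G.roots), Function.Injective γ ∧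
    Filter.Tendsto (fun i => Projectivization.mk ℝ (γ i) (G.ne_zero_of_mem_roots (hγ i)))
      Filter.atTop (𝓝 p)}

/-- The direction `p` is a limit direction arising from the base point `p₀` through the sequence
`g`: the points `g k · p₀` are pairwise distinct and converge to `p`. -/
def IsLimitDirectionThrough (g : ℕ → W) (p₀ p : ℙ ℝ (S → ℝ)) : Prop :=
  Function.Injective (fun k => G.rep (g k) • p₀) ∧
    Filter.Tendsto (fun k => G.rep (g k) • p₀) Filter.atTop (𝓝 p)

/-- The endomorphism of `V` given by `w`. -/
abbrev toEnd (w : W) : Module.End ℝ (S → ℝ) := (G.rep w).toLinearMap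

end GeometricCoxeterSystem

end

/-! ### Jordan chains of Lorentzian isometries -/

namespace LinearMap.BilinForm

variable {V : Type*} [AddCommGroup V] [Module ℝ V]

/-! Everything rests on Jordan chains `φ h = μ h + x`, `φ x = μ x`, `x ≠ 0` of the isometry `φ`
given by `w`. Invariance of the form makes the top `x` isotropic, and in signature `(n-1,1)`
orthogonal isotropic vectors are proportional. Hence a chain at a unimodular eigenvalue can be taken
real, with `μ = ε = ±1` (`im_eq_zero_of_jordan`), and every isotropic eigenvector is a multiple of
`x` (`eq_smul_of_jordan`). Non-diagonalizability supplies a chain, which gives existence and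
uniqueness of the light-like direction; all eigenvalues other than `ε` are semisimple.

For the dynamics, write `y = g + r` by Fitting at `ε`. Then `r` lies in the unimodular subspace and
has a bounded orbit. With `N = εφ - 1`, nilpotent on `g`, one has `φ^k g = ε^k ∑ C(k,j) N^j g`, so
the last nonzero `N^j g` dominates. For `y` outside the subspace this vector has `j ≥ 1` and is the
top of a chain, hence spans the light-like direction. The size of the Jordan block is never needed.
Applied to a simple root outside the proper unimodular subspace, this yields a limit root. -/

/-- In a Lorentzian space, two orthogonal isotropic vectors are linearly dependent. -/
theorem IsLorentzian.exists_eq_smul [FiniteDimensional ℝ V] {B : LinearMap.BilinForm ℝ V}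
    (hB : B.IsLorentzian) (hs : ∀ u v, B u v = B v u) {a b : V} (ha : a ≠ 0) (haa : B a a = 0)
    (hab : B a b = 0) (hbb : B b b = 0) : ∃ c : ℝ, b = c • a := by
  by_contra! h
  have hli : LinearIndependent ℝ ![a, b] :=
    (LinearIndependent.pair_iff' ha).2 fun c hc => h c hc.symm
  have hrank := finrank_span_eq_card hli
  -- The form vanishes on the plane spanned by `a` and `b`, forcing `sigPos + 2 ≤ dim V`, whereas
  -- `sigPos = dim V - 1`.
  have key := QuadraticForm.sigPos_add_finrank_le_of_nonpos (Q := B.toQuadraticMap)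
    (V := Submodule.span ℝ (Set.range ![a, b])) (by
      intro x hx
      rw [Matrix.range_cons, Matrix.range_cons, Matrix.range_empty, Set.union_empty,
        Set.singleton_union, Submodule.mem_span_pair] at hx
      obtain ⟨s, t, rfl⟩ := hx
      simp [haa, hab, hbb, hs b a])
  rw [hrank, ← hB.1] at key
  simp at key

/-- The top of a Jordan chain of length at least two of an isometry is isotropic. -/
theorem apply_self_eq_zero_of_jordan {B : LinearMap.BilinForm ℝ V}
    {φ : Module.End ℝ V} (hφ : ∀ u v, B (φ u) (φ v) = B u v)
    {ε : ℝ} (hε : ε * ε = 1) {h x : V} (hh : φ h = ε • h + x) (hx : φ x = ε • x) :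
    B x x = 0 := by
  have h1 := hφ h x
  rw [hh, hx] at h1
  simp only [map_add, map_smul, LinearMap.add_apply, LinearMap.smul_apply, smul_eq_mul] at h1
  linear_combination ε * h1 - (B x x + ε * B h x) * hε

/-- An isotropic eigenvector is proportional to the top of any nontrivial Jordan chain. -/
theorem IsLorentzian.eq_smul_of_jordan [FiniteDimensional ℝ V] {B : LinearMap.BilinForm ℝ V}
    (hB : B.IsLorentzian) (hs : ∀ u v, B u v = B v u) {φ : Module.End ℝ V}
    (hφ : ∀ u v, B (φ u) (φ v) = B u v) {ε : ℝ} (hε : ε * ε = 1) {h x : V} (hx0 : x ≠ 0)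
    (hh : φ h = ε • h + x) (hx : φ x = ε • x) {μ : ℝ} {v : V} (hvv : B v v = 0)
    (hv : φ v = μ • v) : ∃ c : ℝ, v = c • x := by
  refine hB.exists_eq_smul hs hx0 (apply_self_eq_zero_of_jordan hφ hε hh hx) ?_ hvv
  -- If `B x v ≠ 0`, invariance on `(x, v)` gives `ε μ = 1`; invariance on `(h, v)` then gives `μ *
  -- B x v = 0`.
  by_contra hne
  have h1 := hφ x v
  have h2 := hφ h v
  rw [hx, hv] at h1
  rw [hh, hv] at h2
  simp only [map_add, map_smul, LinearMap.add_apply, LinearMap.smul_apply, smul_eq_mul] at h1 h2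
  have h3 : ε * μ = 1 := mul_right_cancel₀ hne (by linear_combination h1)
  apply hne
  linear_combination ε * h2 - (B x v + ε * B h v) * h3

/-- A nontrivial complex Jordan chain of an isometry of a Lorentzian space, written in real and
imaginary parts, has a real eigenvalue. -/
theorem IsLorentzian.im_eq_zero_of_jordan [FiniteDimensional ℝ V] {B : LinearMap.BilinForm ℝ V}
    (hB : B.IsLorentzian) (hs : ∀ u v, B u v = B v u) {φ : Module.End ℝ V}
    (hφ : ∀ u v, B (φ u) (φ v) = B u v) {α β : ℝ} (hαβ : α ^ 2 + β ^ 2 = 1) {p q a b : V}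
    (hp : φ p = α • p - β • q + a) (hq : φ q = β • p + α • q + b)
    (ha : φ a = α • a - β • b) (hb : φ b = β • a + α • b) (hab : a ≠ 0 ∨ b ≠ 0) : β = 0 := by
  by_contra hβ
  have e1 := hφ p a
  have e2 := hφ q b
  have e3 := hφ p b
  have e4 := hφ q a
  have e5 := hφ a a
  have e6 := hφ b b
  have e7 := hφ a b
  simp only [hp, hq, ha, hb, map_add, map_sub, map_smul, LinearMap.add_apply, LinearMap.sub_apply,
    LinearMap.smul_apply, smul_eq_mul, hs b a] at e1 e2 e3 e4 e5 e6 e7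
  -- Put `μ = α + iβ`, `z = p + iq`, `u = a + ib`. Invariance of the Hermitian extension on `(z, u)`
  -- kills `⟨u, u⟩ = B a a + B b b`.
  have f1 : α * (B a a + B b b) = 0 := by
    linear_combination e1 + e2 - (B p a + B q b) * hαβ
  have f2 : β * (B a a + B b b) = 0 := by
    linear_combination e3 - e4 - (B p b - B q a) * hαβ
  have f3 : B a a + B b b = 0 := (mul_eq_zero.1 f2).resolve_left hβ
  -- For the bilinear extension, `(μ² - 1) B(u, u) = 0` and `μ² - 1 = 2iβμ`; `f4` and `f5` are the
  -- imaginary and real parts of `β μ B(u, u) = 0`.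
  have f4 : β * (β * (B a a - B b b) + 2 * α * B a b) = 0 := by
    linear_combination -e5 + B a a * hαβ
  have f5 : β * (α * (B a a - B b b) - 2 * β * B a b) = 0 := by
    linear_combination e7 - B a b * hαβ
  have f4' := (mul_eq_zero.1 f4).resolve_left hβ
  have f5' := (mul_eq_zero.1 f5).resolve_left hβ
  have f6 : B a a - B b b = 0 := by
    linear_combination β * f4' + α * f5' - (B a a - B b b) * hαβ
  have f7 : B a b = 0 := by
    linear_combination (α * f4' - β * f5') / 2 - B a b * hαβ
  have f8 : B a a = 0 := by linarith
  have f9 : B b b = 0 := by linarith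
  have ha0 : a ≠ 0 := by
    rintro rfl
    rw [map_zero, smul_zero, zero_sub, eq_comm, neg_eq_zero, smul_eq_zero] at ha
    tauto
  -- Now `a` and `b = c a` span a `φ`-invariant real line, which is incompatible with a non-real
  -- eigenvalue.
  obtain ⟨c, rfl⟩ := hB.exists_eq_smul hs ha0 f8 f7 f9
  rw [map_smul, ha, ← sub_eq_zero] at hb
  have : (-β * (c ^ 2 + 1)) • a = 0 := by rw [← hb]; module
  rcases smul_eq_zero.1 this with h | h
  · rcases mul_eq_zero.1 h with h | h
    · exact hβ (neg_eq_zero.1 h)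
    · nlinarith [sq_nonneg c]
  · exact ha0 h

end LinearMap.BilinForm

/-! ### Complexification, unimodular subspace and Fitting complement -/

namespace Module.End

variable {V : Type*} [AddCommGroup V] [Module ℝ V]

/-- The real part of a vector of the complexification. -/
noncomputable def tensorRe (V : Type*) [AddCommGroup V] [Module ℝ V] : ℂ ⊗[ℝ] V →ₗ[ℝ] V :=
  (TensorProduct.lid ℝ V).toLinearMap ∘ₗ LinearMap.rTensor V Complex.reLm

/-- The imaginary part of a vector of the complexification. -/
noncomputable def tensorIm (V : Type*) [AddCommGroup V] [Module ℝ V] : ℂ ⊗[ℝ] V →ₗ[ℝ] V :=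
  (TensorProduct.lid ℝ V).toLinearMap ∘ₗ LinearMap.rTensor V Complex.imLm

@[simp] theorem tensorRe_tmul (c : ℂ) (v : V) : tensorRe V (c ⊗ₜ v) = c.re • v := by
  simp [tensorRe]

@[simp] theorem tensorIm_tmul (c : ℂ) (v : V) : tensorIm V (c ⊗ₜ v) = c.im • v := by
  simp [tensorIm]

theorem one_tmul_tensorRe_add (z : ℂ ⊗[ℝ] V) :
    (1 : ℂ) ⊗ₜ[ℝ] tensorRe V z + Complex.I ⊗ₜ[ℝ] tensorIm V z = z := by
  induction z with
  | zero => simp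
  | tmul c v =>
    rw [tensorRe_tmul, tensorIm_tmul, ← TensorProduct.smul_tmul, ← TensorProduct.smul_tmul,
      ← TensorProduct.add_tmul]
    congr 1
    apply Complex.ext <;> simp
  | add x y hx hy =>
    rw [map_add, map_add, TensorProduct.tmul_add, TensorProduct.tmul_add]
    nth_rewrite 3 [← hx]
    nth_rewrite 3 [← hy]
    abel

theorem tensorRe_smul (c : ℂ) (z : ℂ ⊗[ℝ] V) :
    tensorRe V (c • z) = c.re • tensorRe V z - c.im • tensorIm V z := by
  induction z with
  | zero => simp
  | tmul d v => simp [TensorProduct.smul_tmul', sub_smul, mul_smul]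
  | add x y hx hy => simp only [smul_add, map_add, hx, hy]; abel

theorem tensorIm_smul (c : ℂ) (z : ℂ ⊗[ℝ] V) :
    tensorIm V (c • z) = c.im • tensorRe V z + c.re • tensorIm V z := by
  induction z with
  | zero => simp
  | tmul d v => simp [TensorProduct.smul_tmul', add_smul, mul_smul]; abel
  | add x y hx hy => simp only [smul_add, map_add, hx, hy]; abel

theorem tensorRe_complexify (φ : Module.End ℝ V) (z : ℂ ⊗[ℝ] V) :
    tensorRe V (φ.complexify z) = φ (tensorRe V z) := by
  induction z with
  | zero => simp
  | tmul d v => simp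
  | add x y hx hy => simp only [map_add, hx, hy]

theorem tensorIm_complexify (φ : Module.End ℝ V) (z : ℂ ⊗[ℝ] V) :
    tensorIm V (φ.complexify z) = φ (tensorIm V z) := by
  induction z with
  | zero => simp
  | tmul d v => simp
  | add x y hx hy => simp only [map_add, hx, hy]

theorem complexify_one_tmul (φ : Module.End ℝ V) (v : V) :
    φ.complexify ((1 : ℂ) ⊗ₜ[ℝ] v) = (1 : ℂ) ⊗ₜ[ℝ] φ v := by
  simp

theorem ofReal_smul_one_tmul (a : ℝ) (v : V) :
    (a : ℂ) • ((1 : ℂ) ⊗ₜ[ℝ] v) = (1 : ℂ) ⊗ₜ[ℝ] (a • v) := by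
  rw [TensorProduct.smul_tmul', TensorProduct.tmul_smul, TensorProduct.smul_tmul']
  congr 1

theorem one_tmul_ne_zero {v : V} (hv : v ≠ 0) : (1 : ℂ) ⊗ₜ[ℝ] v ≠ 0 := by
  intro h
  apply hv
  simpa using congrArg (tensorRe V) h

theorem complexify_sub_pow_one_tmul (φ : Module.End ℝ V) (ε : ℝ) (n : ℕ) (v : V) :
    ((φ.complexify - (ε : ℂ) • (1 : Module.End ℂ (ℂ ⊗[ℝ] V))) ^ n) ((1 : ℂ) ⊗ₜ[ℝ] v)
      = (1 : ℂ) ⊗ₜ[ℝ] ((φ - ε • (1 : Module.End ℝ V)) ^ n) v := by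
  induction n with
  | zero => simp
  | succ n ih =>
    rw [pow_succ', pow_succ', Module.End.mul_apply, Module.End.mul_apply, ih,
      LinearMap.sub_apply, LinearMap.sub_apply, complexify_one_tmul, LinearMap.smul_apply,
      Module.End.one_apply, ofReal_smul_one_tmul, ← TensorProduct.tmul_sub]
    simp

/-- If no Jordan chain at `μ` is nontrivial, then generalized eigenvectors are eigenvectors. -/
theorem maxGenEigenspace_le_eigenspace {K E : Type*} [Field K] [AddCommGroup E] [Module K E]
    (f : Module.End K E) (μ : K)
    (h : ∀ z u, f z = μ • z + u → f u = μ • u → u = 0) :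
    f.maxGenEigenspace μ ≤ f.eigenspace μ := by
  intro z hz
  rw [mem_maxGenEigenspace] at hz
  obtain ⟨k, hk⟩ := hz
  rw [mem_eigenspace_iff]
  induction k generalizing z with
  | zero => simp only [pow_zero, one_apply] at hk; simp [hk]
  | succ k ih =>
    rw [pow_succ, mul_apply] at hk
    -- By induction `(f - μ) z` is an eigenvector or zero, so it is the top of a chain under `z`.
    have h1 := ih hk
    have h2 := h z _ (by simp) h1
    simpa [sub_eq_zero] using h2

/-- A nontrivial complex Jordan chain of a Lorentzian isometry at a unimodular eigenvalue comes
from a real one, at eigenvalue `1` or `-1`. -/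
theorem exists_real_jordan [FiniteDimensional ℝ V] {B : LinearMap.BilinForm ℝ V}
    (hB : B.IsLorentzian) (hs : ∀ u v, B u v = B v u) {φ : Module.End ℝ V}
    (hφ : ∀ u v, B (φ u) (φ v) = B u v) {μ : ℂ} (hμ : ‖μ‖ = 1) {z u : ℂ ⊗[ℝ] V}
    (hz : φ.complexify z = μ • z + u) (hu : φ.complexify u = μ • u) (hu0 : u ≠ 0) :
    ∃ ε : ℝ, μ = ε ∧ ε * ε = 1 ∧ ∃ h x, x ≠ 0 ∧ φ h = ε • h + x ∧ φ x = ε • x := by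
  have hp := congrArg (tensorRe V) hz
  have hq := congrArg (tensorIm V) hz
  have ha := congrArg (tensorRe V) hu
  have hb := congrArg (tensorIm V) hu
  simp only [tensorRe_complexify, tensorIm_complexify, map_add, tensorRe_smul, tensorIm_smul]
    at hp hq ha hb
  have hnorm : μ.re ^ 2 + μ.im ^ 2 = 1 := by
    have := Complex.sq_norm μ
    rw [hμ, Complex.normSq_apply] at this
    linarith
  have hne : tensorRe V u ≠ 0 ∨ tensorIm V u ≠ 0 := by
    by_contra! h
    apply hu0
    rw [← one_tmul_tensorRe_add u, h.1, h.2]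
    simp
  have him := hB.im_eq_zero_of_jordan hs hφ hnorm hp hq ha hb hne
  rw [him] at hp hq ha hb hnorm
  refine ⟨μ.re, Complex.ext rfl (by simpa using him), by linarith, ?_⟩
  -- With `μ` real, the real and imaginary parts are separate chains; at least one has nonzero top.
  rcases hne with h | h
  · exact ⟨_, _, h, by simpa using hp, by simpa using ha⟩
  · exact ⟨_, _, h, by simpa using hq, by simpa using hb⟩

/-- A parabolic isometry of a Lorentzian space has a nontrivial real Jordan chain at `1` or
`-1`. -/
theorem IsParabolic.exists_real_jordan [FiniteDimensional ℝ V] {B : LinearMap.BilinForm ℝ V}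
    (hB : B.IsLorentzian) (hs : ∀ u v, B u v = B v u) {φ : Module.End ℝ V}
    (hφ : ∀ u v, B (φ u) (φ v) = B u v) (hw : φ.IsParabolic) :
    ∃ ε : ℝ, ε * ε = 1 ∧ ∃ h x, x ≠ 0 ∧ φ h = ε • h + x ∧ φ x = ε • x := by
  by_contra hcon
  apply hw.2
  rw [IsComplexDiagonalizable, eq_top_iff, ← iSup_maxGenEigenspace_eq_top φ.complexify]
  refine iSup_le fun μ => (maxGenEigenspace_le_eigenspace _ μ ?_).trans ?_
  · intro z u hz hu
    by_contra hu0
    have hμ : ‖μ‖ = 1 := hw.1 μ (hasEigenvalue_of_hasEigenvector ⟨mem_eigenspace_iff.2 hu, hu0⟩)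
    obtain ⟨ε, -, h⟩ := Module.End.exists_real_jordan hB hs hφ hμ hz hu hu0
    exact hcon ⟨ε, h⟩
  · intro z hz
    by_cases hz0 : z = 0
    · simp [hz0]
    · exact Submodule.subset_span ⟨μ, hz, hz0⟩

/-- The Fitting complement of the generalized eigenspace of a nontrivial real Jordan chain lies in
the unimodular subspace: all other eigenvalues are semisimple. -/
theorem IsParabolic.mem_unimodularSubspace_of_mem_range [FiniteDimensional ℝ V]
    {B : LinearMap.BilinForm ℝ V}
    (hB : B.IsLorentzian) (hs : ∀ u v, B u v = B v u) {φ : Module.End ℝ V}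
    (hφ : ∀ u v, B (φ u) (φ v) = B u v) (hw : φ.IsParabolic) {ε : ℝ} (hε : ε * ε = 1)
    {h x : V} (hx0 : x ≠ 0) (hh : φ h = ε • h + x) (hx : φ x = ε • x) {n : ℕ}
    (hn : maxGenEigenspaceIndex φ.complexify ε ≤ n) {r : V}
    (hr : r ∈ LinearMap.range ((φ - ε • (1 : Module.End ℝ V)) ^ n)) :
    r ∈ φ.unimodularSubspace := by
  obtain ⟨r, rfl⟩ := hr
  rw [unimodularSubspace, Submodule.mem_comap, Submodule.restrictScalars_mem,
    TensorProduct.mk_apply, ← complexify_sub_pow_one_tmul]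
  generalize (1 : ℂ) ⊗ₜ[ℝ] r = z
  have hmem : z ∈ ⨆ μ, φ.complexify.maxGenEigenspace μ := by
    rw [iSup_maxGenEigenspace_eq_top]; trivial
  induction hmem using Submodule.iSup_induction' with
  | zero => simp
  | add a b _ _ ha hb => rw [map_add]; exact add_mem ha hb
  | mem μ z hz =>
    by_cases hμε : μ = ε
    · subst hμε
      rw [maxGenEigenspace_eq, mem_genEigenspace_nat, LinearMap.mem_ker] at hz
      obtain ⟨k, rfl⟩ := Nat.exists_eq_add_of_le' hn
      rw [pow_add, mul_apply, hz, map_zero]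
      exact zero_mem _
    · have hz' : z ∈ φ.complexify.eigenspace μ := by
        refine maxGenEigenspace_le_eigenspace _ μ ?_ hz
        intro z u hz hu
        by_contra hu0
        have hμ : ‖μ‖ = 1 :=
          hw.1 μ (hasEigenvalue_of_hasEigenvector ⟨mem_eigenspace_iff.2 hu, hu0⟩)
        -- A second chain would have its isotropic top on the line of `x`, hence the same eigenvalue
        -- `ε`.
        obtain ⟨ε', rfl, hε', h', x', hx0', hh', hx'⟩ :=
          Module.End.exists_real_jordan hB hs hφ hμ hz hu hu0
        obtain ⟨c, rfl⟩ := hB.eq_smul_of_jordan hs hφ hε hx0 hh hx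
          (LinearMap.BilinForm.apply_self_eq_zero_of_jordan hφ hε' hh' hx') hx'
        rw [map_smul, hx, smul_comm] at hx'
        exact hμε (congrArg _ (smul_left_injective ℝ hx0' hx').symm)
      rw [mem_eigenspace_iff] at hz'
      have hpow : ((φ.complexify - (ε : ℂ) • (1 : Module.End ℂ (ℂ ⊗[ℝ] V))) ^ n) z
          = (μ - ε) ^ n • z := by
        clear hn
        induction n with
        | zero => simp
        | succ n ih =>
          rw [pow_succ', mul_apply, ih, map_smul, LinearMap.sub_apply, hz', LinearMap.smul_apply,
            one_apply, ← sub_smul, smul_smul, pow_succ]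
      rw [hpow]
      apply Submodule.smul_mem
      by_cases hz0 : z = 0
      · simp [hz0]
      have hev : φ.complexify.HasEigenvector μ z := ⟨mem_eigenspace_iff.2 hz', hz0⟩
      exact Submodule.subset_span ⟨μ, hw.1 μ (hasEigenvalue_of_hasEigenvector hev), hev⟩

theorem mem_unimodularSubspace_of_eigenvector {φ : Module.End ℝ V} {ε : ℝ} (hε : ε * ε = 1)
    {v : V} (hv : φ v = ε • v) : v ∈ φ.unimodularSubspace := by
  by_cases h0 : v = 0
  · rw [h0]; exact zero_mem _
  refine Submodule.subset_span ⟨ε, ?_, mem_eigenspace_iff.2 ?_, one_tmul_ne_zero h0⟩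
  · rcases mul_self_eq_one_iff.1 hε with rfl | rfl <;> simp
  · rw [TensorProduct.mk_apply, complexify_one_tmul, hv, ofReal_smul_one_tmul]

/-- The unimodular subspace of a parabolic transformation is proper. -/
theorem IsParabolic.unimodularSubspace_ne_top {φ : Module.End ℝ V} (hw : φ.IsParabolic) :
    φ.unimodularSubspace ≠ ⊤ := by
  intro htop
  apply hw.2
  rw [IsComplexDiagonalizable, eq_top_iff]
  intro z _
  induction z with
  | zero => exact zero_mem _
  | add a b ha hb => exact add_mem (ha trivial) (hb trivial)
  | tmul c v =>
    have hv : v ∈ φ.unimodularSubspace := htop ▸ Submodule.mem_top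
    rw [unimodularSubspace, Submodule.mem_comap, Submodule.restrictScalars_mem,
      TensorProduct.mk_apply] at hv
    have hle : {z : ℂ ⊗[ℝ] V | ∃ μ : ℂ, ‖μ‖ = 1 ∧ φ.complexify.HasEigenvector μ z} ⊆
        {z | ∃ μ : ℂ, φ.complexify.HasEigenvector μ z} := fun z ⟨μ, _, h⟩ => ⟨μ, h⟩
    have := Submodule.smul_mem _ c (Submodule.span_mono hle hv)
    rwa [TensorProduct.smul_tmul', smul_eq_mul, mul_one] at this

/-- Linear functionals are bounded along the orbits in the unimodular subspace. -/
theorem exists_bound_of_mem_unimodularSubspace {φ : Module.End ℝ V} {u : V}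
    (hu : u ∈ φ.unimodularSubspace) (f : V →ₗ[ℝ] ℝ) : ∃ C, ∀ k : ℕ, |f ((φ ^ k) u)| ≤ C := by
  -- `F` is the complex-linear extension of `f`; on a unimodular eigenvector `|F|` is constant along
  -- the orbit.
  set F : ℂ ⊗[ℝ] V → ℂ := fun z => ⟨f (tensorRe V z), f (tensorIm V z)⟩ with hF
  have hFadd : ∀ a b, F (a + b) = F a + F b := fun a b => by
    apply Complex.ext <;> simp [hF]
  have hFsmul : ∀ (c : ℂ) a, F (c • a) = c * F a := fun c a => by
    apply Complex.ext <;> simp [hF, tensorRe_smul, tensorIm_smul, add_comm]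
  have hF1 : ∀ v, F ((1 : ℂ) ⊗ₜ[ℝ] v) = f v := fun v => by
    apply Complex.ext <;> simp [hF]
  have key : ∀ z ∈ Submodule.span ℂ {z : ℂ ⊗[ℝ] V | ∃ μ : ℂ, ‖μ‖ = 1 ∧
      φ.complexify.HasEigenvector μ z}, ∃ C, ∀ k : ℕ, ‖F ((φ.complexify ^ k) z)‖ ≤ C := by
    intro z hz
    induction hz using Submodule.span_induction with
    | zero => exact ⟨‖F 0‖, by simp⟩
    | mem z hz =>
      obtain ⟨μ, hμ, hz⟩ := hz
      exact ⟨‖F z‖, fun k => by rw [hz.pow_apply, hFsmul, norm_mul, norm_pow, hμ, one_pow, one_mul]⟩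
    | add a b _ _ ha hb =>
      obtain ⟨C, hC⟩ := ha
      obtain ⟨D, hD⟩ := hb
      exact ⟨C + D, fun k => by
        rw [map_add, hFadd]; exact (norm_add_le _ _).trans (add_le_add (hC k) (hD k))⟩
    | smul c a _ ha =>
      obtain ⟨C, hC⟩ := ha
      exact ⟨‖c‖ * C, fun k => by
        rw [map_smul, hFsmul, norm_mul]; exact mul_le_mul_of_nonneg_left (hC k) (norm_nonneg _)⟩
  obtain ⟨C, hC⟩ := key _ hu
  refine ⟨C, fun k => ?_⟩
  have hpow : (φ.complexify ^ k) ((1 : ℂ) ⊗ₜ[ℝ] u) = (1 : ℂ) ⊗ₜ[ℝ] (φ ^ k) u := by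
    clear hC
    induction k with
    | zero => simp
    | succ k ih => rw [pow_succ', mul_apply, ih, complexify_one_tmul, pow_succ', mul_apply]
  have := hC k
  rwa [TensorProduct.mk_apply, hpow, hF1, Complex.norm_real] at this

end Module.End

/-! ### Growth of orbits -/

open Filter in
theorem tendsto_choose_div_choose_zero {j m : ℕ} (hjm : j < m) :
    Tendsto (fun k : ℕ => (k.choose j : ℝ) / k.choose m) atTop (𝓝 0) := by
  have h1 : (fun k : ℕ => (k : ℝ) ^ j) =o[atTop] (fun k : ℕ => (k : ℝ) ^ m) :=
    (Asymptotics.isLittleO_pow_pow_atTop_of_lt (𝕜 := ℝ) hjm).comp_tendsto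
      tendsto_natCast_atTop_atTop
  exact (((isTheta_choose j).trans_isLittleO h1).trans_isTheta
    (isTheta_choose m).symm).tendsto_div_nhds_zero

namespace Module.End

open Filter

/-- The number of terms is independent of `k`, so limits can be taken termwise: binomials vanish for
`j > k`, powers of `N` for `j > m`. -/
theorem one_add_pow_apply_eq_sum {R E : Type*} [CommRing R] [AddCommGroup E] [Module R E]
    (N : Module.End R E) {g : E} {m : ℕ} (hg : (N ^ (m + 1)) g = 0) (k : ℕ) :
    ((1 + N) ^ k) g = ∑ j ∈ Finset.range (m + 1), (k.choose j : R) • (N ^ j) g := by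
  have hzero : ∀ j, m + 1 ≤ j → (N ^ j) g = 0 := fun j hj => by
    obtain ⟨i, rfl⟩ := Nat.exists_eq_add_of_le' hj
    rw [pow_add, mul_apply, hg, map_zero]
  have h1 : ((1 + N) ^ k) g = ∑ j ∈ Finset.range (k + 1), (k.choose j : R) • (N ^ j) g := by
    rw [add_comm, (Commute.one_right N).add_pow, LinearMap.sum_apply]
    refine Finset.sum_congr rfl fun j _ => ?_
    rw [one_pow, mul_one, (Nat.cast_commute _ _).symm.eq, mul_apply, Nat.cast_smul_eq_nsmul]
    simp
  rw [h1]
  have e1 := Finset.sum_subset (Finset.range_subset_range.2 (le_max_left (k + 1) (m + 1)))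
    (f := fun j => (k.choose j : R) • (N ^ j) g) fun j _ hj => by
      rw [Finset.mem_range, not_lt] at hj
      simp [Nat.choose_eq_zero_of_lt hj]
  have e2 := Finset.sum_subset (Finset.range_subset_range.2 (le_max_right (k + 1) (m + 1)))
    (f := fun j => (k.choose j : R) • (N ^ j) g) fun j _ hj => by
      rw [Finset.mem_range, not_lt] at hj
      simp [hzero j hj]
  rw [e1, e2]

/-- The binomial `C(k,m)` outgrows all `C(k,j)` with `j < m`, so only the top term survives. -/
theorem tendsto_inv_choose_smul_one_add_pow {E : Type*} [AddCommGroup E] [Module ℝ E]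
    [TopologicalSpace E] [IsTopologicalAddGroup E] [ContinuousSMul ℝ E]
    (N : Module.End ℝ E) {g : E} {m : ℕ} (hg : (N ^ (m + 1)) g = 0) :
    Tendsto (fun k : ℕ => (k.choose m : ℝ)⁻¹ • ((1 + N) ^ k) g) atTop (𝓝 ((N ^ m) g)) := by
  have h1 : ∀ j ∈ Finset.range m, Tendsto
      (fun k : ℕ => ((k.choose j : ℝ) / k.choose m) • (N ^ j) g) atTop (𝓝 0) := fun j hj => by
    simpa using (tendsto_choose_div_choose_zero (Finset.mem_range.1 hj)).smul_const ((N ^ j) g)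
  have h2 := (tendsto_finsetSum _ h1).add (tendsto_const_nhds (x := (N ^ m) g))
  rw [Finset.sum_const_zero, zero_add] at h2
  refine h2.congr' ?_
  filter_upwards [eventually_ge_atTop m] with k hk
  have hne : (k.choose m : ℝ) ≠ 0 := by exact_mod_cast (Nat.choose_pos hk).ne'
  rw [one_add_pow_apply_eq_sum N hg, Finset.sum_range_succ, smul_add, smul_smul,
    inv_mul_cancel₀ hne, one_smul, Finset.smul_sum]
  simp only [smul_smul, div_eq_inv_mul]

theorem tendsto_smul_pow_of_mem_unimodularSubspace {ι : Type*} [Finite ι]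
    {φ : Module.End ℝ (ι → ℝ)} {u : ι → ℝ} (hu : u ∈ φ.unimodularSubspace) {c : ℕ → ℝ}
    (hc : Tendsto c atTop (𝓝 0)) : Tendsto (fun k => c k • (φ ^ k) u) atTop (𝓝 0) := by
  rw [tendsto_pi_nhds]
  intro i
  obtain ⟨C, hC⟩ := exists_bound_of_mem_unimodularSubspace hu (LinearMap.proj i)
  refine hc.zero_mul_isBoundedUnder_le ⟨C, ?_⟩
  exact eventually_map.2 (Eventually.of_forall hC)

/-- Off the unimodular subspace, the rescaled orbits of a parabolic isometry converge to
isotropic eigenvectors. -/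
theorem IsParabolic.exists_tendsto {ι : Type*} [Finite ι] {B : LinearMap.BilinForm ℝ (ι → ℝ)}
    (hB : B.IsLorentzian) (hs : ∀ u v, B u v = B v u) {φ : Module.End ℝ (ι → ℝ)}
    (hφ : ∀ u v, B (φ u) (φ v) = B u v) (hw : φ.IsParabolic) {y : ι → ℝ}
    (hy : y ∉ φ.unimodularSubspace) :
    ∃ (ε : ℝ) (c : ℕ → ℝ) (x : ι → ℝ), ε * ε = 1 ∧ x ≠ 0 ∧ B x x = 0 ∧ φ x = ε • x ∧
      (∀ᶠ k in atTop, c k ≠ 0) ∧ Tendsto (fun k => c k • (φ ^ k) y) atTop (𝓝 x) := by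
  obtain ⟨ε, hε, h, x, hx0, hh, hx⟩ := IsParabolic.exists_real_jordan hB hs hφ hw
  -- `n` is large enough both for the real Fitting decomposition and to kill the complex generalized
  -- eigenspace at `ε`.
  obtain ⟨n, hn, hn'⟩ := (LinearMap.eventually_isCompl_ker_pow_range_pow
    (φ - ε • (1 : Module.End ℝ (ι → ℝ))) |>.and <|
    (eventually_ge_atTop (maxGenEigenspaceIndex φ.complexify ε))).exists
  obtain ⟨g, hg, r, hr, rfl⟩ := Submodule.mem_sup.1
    (hn.sup_eq_top ▸ Submodule.mem_top : y ∈ _ ⊔ _)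
  have hrU := hw.mem_unimodularSubspace_of_mem_range hB hs hφ hε hx0 hh hx hn' hr
  have hgU : g ∉ φ.unimodularSubspace := fun h => hy (add_mem h hrU)
  set N : Module.End ℝ (ι → ℝ) := ε • φ - 1 with hN
  have hNφ : N = ε • (φ - ε • 1) := by rw [smul_sub, smul_smul, hε, one_smul]
  have hφN : ∀ v, φ v = ε • v + ε • N v := fun v => by
    rw [hN, LinearMap.sub_apply, LinearMap.smul_apply, one_apply, smul_sub, smul_smul, hε, one_smul]
    abel
  have hNg : (N ^ n) g = 0 := by
    rw [hNφ, smul_pow, LinearMap.smul_apply, LinearMap.mem_ker.1 hg, smul_zero]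
  classical
  have hex : ∃ n, (N ^ n) g = 0 := ⟨n, hNg⟩
  -- Nilpotency order `0` means `g = 0` and order `1` an eigenvector; both would put `g` in the
  -- unimodular subspace.
  obtain ⟨m, hm⟩ : ∃ m, Nat.find hex = m + 2 := by
    have hspec := Nat.find_spec hex
    rcases hfind : Nat.find hex with _ | _ | m
    · rw [hfind, pow_zero, one_apply] at hspec
      exact absurd (hspec ▸ zero_mem _) hgU
    · rw [hfind, zero_add, pow_one] at hspec
      refine absurd (mem_unimodularSubspace_of_eigenvector hε ?_) hgU
      rw [hφN, hspec, smul_zero, add_zero]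
    · exact ⟨m, rfl⟩
  have h0 : (N ^ (m + 1 + 1)) g = 0 := by simpa [hm] using Nat.find_spec hex
  have h1 : (N ^ (m + 1)) g ≠ 0 := Nat.find_min hex (by omega)
  have hx1 : φ ((N ^ (m + 1)) g) = ε • (N ^ (m + 1)) g := by
    rw [hφN, ← mul_apply, ← pow_succ', h0, smul_zero, add_zero]
  -- The factor `ε^k` turns `φ^k` into `(1 + N)^k`, whose leading coefficient on `g` is `C(k, m+1)`.
  refine ⟨ε, fun k => (k.choose (m + 1) : ℝ)⁻¹ * ε ^ k, (N ^ (m + 1)) g, hε, h1, ?_, hx1, ?_, ?_⟩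
  · have h2 := LinearMap.BilinForm.apply_self_eq_zero_of_jordan hφ hε (h := (N ^ m) g)
      (x := ε • (N ^ (m + 1)) g) (by rw [hφN, ← mul_apply, ← pow_succ'])
      (by rw [map_smul, hx1])
    simp only [map_smul, LinearMap.smul_apply, smul_eq_mul] at h2
    rwa [← mul_assoc, hε, one_mul] at h2
  · filter_upwards [eventually_ge_atTop (m + 1)] with k hk
    have hε0 : ε ≠ 0 := by rintro rfl; simp at hε
    have : (k.choose (m + 1) : ℝ) ≠ 0 := by exact_mod_cast (Nat.choose_pos hk).ne'
    positivity
  · have t1 := tendsto_inv_choose_smul_one_add_pow N h0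
    have hc : Tendsto (fun k : ℕ => (k.choose (m + 1) : ℝ)⁻¹ * ε ^ k) atTop (𝓝 0) := by
      have h3 := tendsto_choose_div_choose_zero (Nat.succ_pos m)
      simp only [Nat.choose_zero_right, Nat.cast_one, one_div] at h3
      refine h3.zero_mul_isBoundedUnder_le ⟨1, eventually_map.2 (Eventually.of_forall fun k => ?_)⟩
      rcases mul_self_eq_one_iff.1 hε with rfl | rfl <;> simp
    have t2 := t1.add (tendsto_smul_pow_of_mem_unimodularSubspace hrU hc)
    rw [add_zero] at t2
    refine t2.congr fun k => ?_
    rw [map_add, smul_add, hN, add_sub_cancel, smul_pow, LinearMap.smul_apply, smul_smul]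

end Module.End

/-! ### Passage to projective space -/

theorem Projectivization.tendsto_mk_of_tendsto_smul {V α : Type*} [AddCommGroup V] [Module ℝ V]
    [TopologicalSpace V] {l : Filter α} {v : α → V} (hv : ∀ i, v i ≠ 0)
    {c : α → ℝ} (hc : ∀ᶠ i in l, c i ≠ 0) {x : V} (hx : x ≠ 0)
    (h : Filter.Tendsto (fun i => c i • v i) l (𝓝 x)) :
    Filter.Tendsto (fun i => Projectivization.mk ℝ (v i) (hv i)) l
      (𝓝 (Projectivization.mk ℝ x hx)) := by
  classical
  -- A lift to `V ∖ {0}`; the default `x` is used only where `c i = 0`, which eventually does not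
  -- happen.
  let u : α → {v : V // v ≠ 0} := fun i =>
    if hi : c i = 0 then ⟨x, hx⟩ else ⟨c i • v i, smul_ne_zero hi (hv i)⟩
  have hu : Filter.Tendsto u l (𝓝 ⟨x, hx⟩) := by
    rw [tendsto_subtype_rng]
    refine h.congr' ?_
    filter_upwards [hc] with i hi
    simp [u, hi]
  have hcont : Continuous (Projectivization.mk' ℝ : {v : V // v ≠ 0} → ℙ ℝ V) :=
    continuous_coinduced_rng
  refine ((hcont.tendsto _).comp hu).congr' ?_
  filter_upwards [hc] with i hi
  simp only [u, hi, Function.comp_apply, dif_neg, not_false_eq_true]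
  rw [Projectivization.mk'_eq_mk, Projectivization.mk_eq_mk_iff']
  exact ⟨c i, rfl⟩

/-! ### Application to the geometric representation -/

namespace GeometricCoxeterSystem

variable {S : Type*} {M : CoxeterMatrix S} {W : Type*} [Group W]
  (G : GeometricCoxeterSystem M W) [Fintype S] [DecidableEq S]

theorem form_comm (u v : S → ℝ) : G.form u v = G.form v u := by
  have h : G.gram.transpose = G.gram := by
    ext s t; exact G.gram_symm t s
  rw [form, Matrix.toBilin'_apply', Matrix.toBilin'_apply', Matrix.dotProduct_mulVec,
    ← Matrix.mulVec_transpose, h, dotProduct_comm]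

theorem form_rep_apply (w : W) (u v : S → ℝ) : G.form (G.rep w u) (G.rep w v) = G.form u v := by
  induction w using G.toCoxeterSystem.simple_induction generalizing u v with
  | one => simp
  | mul w w' h h' => rw [map_mul, LinearEquiv.mul_apply, LinearEquiv.mul_apply, h, h']
  | simple s =>
    rw [rep_simple, simpleReflection, LinearMap.BilinForm.vectorReflection_apply,
      LinearMap.BilinForm.vectorReflection_apply]
    simp only [form_simpleRoot_self, map_sub, map_smul, LinearMap.sub_apply, LinearMap.smul_apply,
      smul_eq_mul, G.form_comm (G.simpleRoot s) v]
    ring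

theorem rep_pow_apply (w : W) (k : ℕ) (v : S → ℝ) : G.rep (w ^ k) v = ((G.toEnd w) ^ k) v := by
  induction k with
  | zero => simp
  | succ k ih =>
    rw [pow_succ', pow_succ', map_mul, LinearEquiv.mul_apply, Module.End.mul_apply, ih]
    rfl

theorem eq_of_isLightlikeEigendirection (hG : G.IsLorentzian) {w : W}
    (hw : (G.toEnd w).IsParabolic) {p q : ℙ ℝ (S → ℝ)}
    (hp : (G.toEnd w).IsLightlikeEigendirection G.form p)
    (hq : (G.toEnd w).IsLightlikeEigendirection G.form q) : p = q := by
  obtain ⟨ε, hε, h, x, hx0, hh, hx⟩ :=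
    Module.End.IsParabolic.exists_real_jordan hG G.form_comm (G.form_rep_apply w) hw
  have key : ∀ p, (G.toEnd w).IsLightlikeEigendirection G.form p →
      p = Projectivization.mk ℝ x hx0 := by
    rintro _ ⟨v, hv0, rfl, hvv, μ, hv⟩
    obtain ⟨c, rfl⟩ := LinearMap.BilinForm.IsLorentzian.eq_smul_of_jordan hG G.form_comm
      (G.form_rep_apply w) hε hx0 hh hx hvv hv.apply_eq_smul
    exact (Projectivization.mk_eq_mk_iff' ℝ _ _ _ _).2 ⟨c, rfl⟩
  rw [key p hp, key q hq]

theorem exists_isLightlikeEigendirection (hG : G.IsLorentzian) {w : W}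
    (hw : (G.toEnd w).IsParabolic) :
    ∃ p, (G.toEnd w).IsLightlikeEigendirection G.form p := by
  obtain ⟨ε, hε, h, x, hx0, hh, hx⟩ :=
    Module.End.IsParabolic.exists_real_jordan hG G.form_comm (G.form_rep_apply w) hw
  exact ⟨_, x, hx0, rfl,
    LinearMap.BilinForm.apply_self_eq_zero_of_jordan (G.form_rep_apply w) hε hh hx, ε,
    Module.End.mem_eigenspace_iff.2 hx, hx0⟩

theorem rep_pow_smul_mk (w : W) (k : ℕ) {y : S → ℝ} (hy : y ≠ 0) :
    G.rep (w ^ k) • Projectivization.mk ℝ y hy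
      = Projectivization.mk ℝ (G.rep (w ^ k) y) ((LinearEquiv.map_ne_zero_iff _).2 hy) :=
  rfl

/-- Under the powers of a parabolic element, directions off the unimodular subspace converge to
the light-like eigendirection. -/
theorem isLimitDirectionThrough_of_isParabolic (hG : G.IsLorentzian) {w : W}
    (hw : (G.toEnd w).IsParabolic) {p : ℙ ℝ (S → ℝ)}
    (hp : (G.toEnd w).IsLightlikeEigendirection G.form p) {y : S → ℝ} (hy : y ≠ 0)
    (hyU : y ∉ (G.toEnd w).unimodularSubspace) :
    G.IsLimitDirectionThrough (fun k => w ^ k) (Projectivization.mk ℝ y hy) p := by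
  obtain ⟨ε, c, x, hε, hx0, hxx, hx, hc, ht⟩ :=
    hw.exists_tendsto hG G.form_comm (G.form_rep_apply w) hyU
  have hpx : p = Projectivization.mk ℝ x hx0 := G.eq_of_isLightlikeEigendirection hG hw hp
    ⟨x, hx0, rfl, hxx, ε, Module.End.mem_eigenspace_iff.2 hx, hx0⟩
  simp only [← G.rep_pow_apply] at ht
  refine ⟨?_, ?_⟩
  · suffices H : ∀ k l : ℕ, k < l → G.rep (w ^ k) • Projectivization.mk ℝ y hy
        ≠ G.rep (w ^ l) • Projectivization.mk ℝ y hy by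
      intro k l heq
      rcases lt_trichotomy k l with h | h | h
      · exact absurd heq (H k l h)
      · exact h
      · exact absurd heq.symm (H l k h)
    intro k l hkl heq
    refine hyU ?_
    simp only [rep_pow_smul_mk] at heq
    obtain ⟨a, ha⟩ := (Projectivization.mk_eq_mk_iff' ℝ _ _ _ _).1 heq.symm
    obtain ⟨d, rfl⟩ := Nat.exists_eq_add_of_lt hkl
    -- A coincidence of directions makes `w^(d+1)` preserve the line of `w^k y`, so the orbit
    -- returns to it infinitely often. The line is closed, hence contains the limit `x`.
    have hper : ∀ j : ℕ, G.rep (w ^ (k + (d + 1) * j)) y ∈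
        Submodule.span ℝ {G.rep (w ^ k) y} := by
      intro j
      induction j with
      | zero => simp
      | succ j ih =>
        obtain ⟨b, hb⟩ := Submodule.mem_span_singleton.1 ih
        refine Submodule.mem_span_singleton.2 ⟨b * a, ?_⟩
        have e1 : k + (d + 1) * (j + 1) = (d + 1) + (k + (d + 1) * j) := by ring
        rw [e1, pow_add, map_mul, LinearEquiv.mul_apply, ← hb, map_smul, ← LinearEquiv.mul_apply,
          ← map_mul, ← pow_add, mul_smul, ha]
        congr 4
        ring
    have hmem : x ∈ Submodule.span ℝ {G.rep (w ^ k) y} := by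
      refine (Submodule.closed_of_finiteDimensional _).mem_of_frequently_of_tendsto ?_ ht
      rw [Filter.frequently_atTop]
      intro n
      exact ⟨k + (d + 1) * n, by nlinarith, Submodule.smul_mem _ _ (hper n)⟩
    obtain ⟨b, rfl⟩ := Submodule.mem_span_singleton.1 hmem
    refine Module.End.mem_unimodularSubspace_of_eigenvector hε ?_
    have hb : b ≠ 0 := by rintro rfl; simp at hx0
    have h1 : G.rep w (G.rep (w ^ k) y) = ε • G.rep (w ^ k) y := by
      apply smul_right_injective _ hb
      change b • _ = b • _
      rw [← map_smul, smul_comm b ε]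
      exact hx
    -- Since `w^k` commutes with `w`, `y` itself is an eigenvector for `ε`, against `hyU`.
    apply (G.rep (w ^ k)).injective
    rw [map_smul, ← h1]
    change (G.rep (w ^ k) * G.rep w) y = (G.rep w * G.rep (w ^ k)) y
    rw [← map_mul, ← map_mul, ← pow_succ, ← pow_succ']
  · rw [hpx]
    exact Projectivization.tendsto_mk_of_tendsto_smul _ hc hx0 ht

/-- Simple roots span `V`, so one of them avoids the proper unimodular subspace; its orbit consists
of roots, distinct because their directions are. -/
theorem mem_limitRoots_of_isParabolic (hG : G.IsLorentzian) {w : W}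
    (hw : (G.toEnd w).IsParabolic) {p : ℙ ℝ (S → ℝ)}
    (hp : (G.toEnd w).IsLightlikeEigendirection G.form p) : p ∈ G.limitRoots := by
  obtain ⟨s, hs⟩ : ∃ s, G.simpleRoot s ∉ (G.toEnd w).unimodularSubspace := by
    by_contra! h
    apply hw.unimodularSubspace_ne_top
    rw [eq_top_iff, ← (Pi.basisFun ℝ S).span_eq, Submodule.span_le]
    rintro _ ⟨s, rfl⟩
    simpa [simpleRoot] using h s
  have hroot : ∀ k, G.rep (w ^ k) (G.simpleRoot s) ∈ G.roots := fun k => ⟨w ^ k, s, rfl⟩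
  have hs0 : G.simpleRoot s ≠ 0 := by
    simpa using G.ne_zero_of_mem_roots (hroot 0)
  have hlim := G.isLimitDirectionThrough_of_isParabolic hG hw hp hs0 hs
  refine ⟨_, hroot, fun k l hkl => hlim.1 ?_, hlim.2⟩
  simp only [rep_pow_smul_mk]
  congr 1

end GeometricCoxeterSystem

theorem mainTheorem6 {S : Type*} [Fintype S] [DecidableEq S] {M : CoxeterMatrix S}
    {W : Type*} [Group W] (G : GeometricCoxeterSystem M W) (hG : G.IsLorentzian)
    (w : W) (hw : (G.toEnd w).IsParabolic) :
    (∃! p : ℙ ℝ (S → ℝ), (G.toEnd w).IsLightlikeEigendirection G.form p) ∧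
    ∀ p : ℙ ℝ (S → ℝ), (G.toEnd w).IsLightlikeEigendirection G.form p →
      p ∈ G.limitRoots ∧
      ∀ (y : S → ℝ) (hy : y ≠ 0), y ∉ (G.toEnd w).unimodularSubspace →
        G.IsLimitDirectionThrough (fun k => w ^ k) (Projectivization.mk ℝ y hy) p := by
  exact ⟨existsUnique_of_exists_of_unique (G.exists_isLightlikeEigendirection hG hw)
      fun _ _ => G.eq_of_isLightlikeEigendirection hG hw,
    fun _ hp => ⟨G.mem_limitRoots_of_isParabolic hG hw hp,
      fun _ hy hyU => G.isLimitDirectionThrough_of_isParabolic hG hw hp hy hyU⟩⟩
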